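/- **Theorem.** There is a universal constant $C>0$ such that the following holds for all integers $n\ge 1$ and $d,h,m,\ell\ge 0$. A *self-attention head* $A\colon\{0,1\}^n\to\mathbb R^d$ is a function of the form $$A(x)=\frac{\sum_{i=1}^n \exp(\langle q(x_n),k_i(x_i)\rangle)\,v_i(x_i)}{\sum_{i=1}^n \exp(\langle q(x_n),k_i(x_i)\rangle)},$$ where $q,k_i\colon\{0,1\}\to\mathcal H$ and $v_i\colon\{0,1\}\to\mathbb R^d$ are arbitrary functions and $\mathcal H$ is a real inner product space. Let $A_1,\dots,A_h$ be self-attention heads (their inner product spaces may differ) such that $$A_1(x)+\dots+A_h(x)\in[-1,1]^d\qquad\text{for every }x\in\{0,1\}^n .$$ Let $u\colon[-1,1]^d\to\mathbb R$ be computed by a scalar-output layered feed-forward network with at least one and at most $\ell$ layers and at most $m$ gates in each layer, where each gate computes $z\mapsto\max\{0,a^{\mathsf T}z+b\}$ from the vector $z$ of values of the preceding layer (from the input, for the first layer), with $\|a\|_1+|b|\le 1$, and $(a,b)$ may differ between gates. The output of the network is the value of a gate of its last layer or, more generally, $a^{\mathsf T}z+b$, where $z$ is the vector of values of the last layer and $\|a\|_1+|b|\le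 1$. Put $$T(x)=u\bigl(A_1(x)+\dots+A_h(x)\bigr),\qquad x\in\{0,1\}^n .$$ Suppose that, for some $\tau\in\mathbb R$ and $\gamma\in(0,1]$, every $x\in\{0,1\}^n$ satisfies $T(x)\ge\tau+\gamma$ if $x_1+\dots+x_n$ is odd, and $T(x)\le\tau-\gamma$ if $x_1+\dots+x_n$ is even. Then $$h\,m^{\ell}\,\Bigl(\ln\frac{2\ell}{\gamma}\Bigr)^{2\ell}\ \ge\ \frac nC .$$ -/

import Mathlib

noncomputable section

namespace ParityAttention

/-- The index of the last position of an input of length `n ≥ 1`. -/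
def lastIdx (n : ℕ) [NeZero n] : Fin n :=
  ⟨n - 1, Nat.sub_one_lt (NeZero.ne n)⟩

/-- The data of a self-attention head on `n` binary inputs with value-embedding dimension `d`:
a real inner product space together with arbitrary query, (position-specific) key and
(position-specific) value embeddings. -/
structure SelfAttentionHead (n d : ℕ) where
  /-- the inner product space of queries and keys -/
  Space : Type*
  [normed : NormedAddCommGroup Space]
  [inner : InnerProductSpace ℝ Space]
  /-- query embedding -/
  query : Fin 2 → Space
  /-- key embeddings -/
  key : Fin n → Fin 2 → Space
  /-- value embeddings -/
  value : Fin n → Fin 2 → EuclideanSpace ℝ (Fin d)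

attribute [instance] SelfAttentionHead.normed SelfAttentionHead.inner

namespace SelfAttentionHead

variable {n d : ℕ} [NeZero n]

/-- The unnormalized attention weight that the last position gives to position `i`. -/
def weight (A : SelfAttentionHead n d) (x : Fin n → Fin 2) (i : Fin n) : ℝ :=
  Real.exp (Inner.inner ℝ (A.query (x (lastIdx n))) (A.key i (x i)))

/-- The function computed by a self-attention head (output at the last position). -/
def eval (A : SelfAttentionHead n d) (x : Fin n → Fin 2) : EuclideanSpace ℝ (Fin d) :=
  (∑ i, A.weight x i)⁻¹ • ∑ i, A.weight x i • A.value i (x i)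

end SelfAttentionHead

/-- The sum of the outputs of `h` self-attention heads. -/
def headSum {n d h : ℕ} [NeZero n] (A : Fin h → SelfAttentionHead n d)
    (x : Fin n → Fin 2) : EuclideanSpace ℝ (Fin d) :=
  ∑ j, (A j).eval x

/-- The self-attention layer with heads `A` post-processed by `u`. -/
def attentionLayer {n d h : ℕ} [NeZero n] (A : Fin h → SelfAttentionHead n d)
    (u : EuclideanSpace ℝ (Fin d) → ℝ) (x : Fin n → Fin 2) : ℝ :=
  u (headSum A x)

/-- The parity function on `n` bits. -/
def parity (n : ℕ) (x : Fin n → Fin 2) : Fin 2 :=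
  if Odd (∑ i, (x i : ℕ)) then 1 else 0

/-- `f` represents `g` with threshold `τ` and margin `γ`. -/
def Represents {n : ℕ} (τ γ : ℝ) (f : (Fin n → Fin 2) → ℝ) (g : (Fin n → Fin 2) → Fin 2) :
    Prop :=
  ∀ x, (g x = 1 → f x ≥ τ + γ) ∧ (g x = 0 → f x ≤ τ - γ)

/-- The rectified linear unit. -/
def relu (t : ℝ) : ℝ := max 0 t

/-- An affine form `z ↦ aᵀ z + b` with `‖a‖₁ + |b| ≤ 1`. -/
structure NormalizedAffine (w : ℕ) where
  a : Fin w → ℝ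
  b : ℝ
  norm_le : ∑ j, |a j| + |b| ≤ 1

/-- The value of a normalized affine form. -/
def NormalizedAffine.eval {w : ℕ} (g : NormalizedAffine w) (z : Fin w → ℝ) : ℝ :=
  ∑ j, g.a j * z j + g.b

/-- `ReLULayers d m k w`: a stack of `k` layers of normalized ReLU gates on `d` real inputs, each
layer having at most `m` gates and reading the values of the layer before it; the last of these
layers has `w` values. -/
inductive ReLULayers (d m : ℕ) : ℕ → ℕ → Type
  | input : ReLULayers d m 0 d
  | layer {k w : ℕ} (N : ReLULayers d m k w) (w' : ℕ) (hw : w' ≤ m)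
      (gate : Fin w' → NormalizedAffine w) : ReLULayers d m (k + 1) w'

/-- The values of the last layer of a stack of layers on the input `y`. -/
def ReLULayers.eval {d m : ℕ} :
    {k w : ℕ} → ReLULayers d m k w → (Fin d → ℝ) → (Fin w → ℝ)
  | _, _, .input, y => y
  | _, _, .layer N _ _ gate, y => fun i => relu ((gate i).eval (N.eval y))

/-- A scalar-output normalized ReLU network on `d` real inputs with at least one and at most `ℓ`
layers of at most `m` ReLU gates each.  The scalar output is a normalized affine form in the values
of the last layer; a coordinate form makes the output the value of a single gate of that layer. -/
structure NormalizedReLUNetwork (d m ℓ : ℕ) where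
  depth : ℕ
  one_le_depth : 1 ≤ depth
  depth_le : depth ≤ ℓ
  width : ℕ
  layers : ReLULayers d m depth width
  output : NormalizedAffine width

/-- The function computed by a network. -/
def NormalizedReLUNetwork.eval {d m ℓ : ℕ} (N : NormalizedReLUNetwork d m ℓ) (y : Fin d → ℝ) : ℝ :=
  N.output.eval (N.layers.eval y)

/-- The cube `[-1,1]^d`. -/
def cube (d : ℕ) : Set (EuclideanSpace ℝ (Fin d)) :=
  {y | ∀ k, y k ∈ Set.Icc (-1 : ℝ) 1}

end ParityAttention

end

/-! Write `x_n` for the last bit. Each head is a quotient of two sums whose terms depend only on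
`x_n` and one further bit, so `h` heads have a common denominator of degree `h`, where dependence on
`x_n` is free (`lowDegree` with `T = {lastIdx n}`).

Newman's rational functions approximate ReLU on `[-1, 1]` within `exp (-L)` in degree about `L ^ 2`
(`exists_newmanRelu_approx`). Replacing every gate by one multiplies the degree by at most `m * L ^
2` per layer, while the normalization of the gates makes errors merely add up
(`ReLULayers.exists_approx`). With `L = ln (2ℓ/γ)` the total error is at most `γ / 2`.

The result is `P / Q` with `Q > 0`, and `P - τ Q` has the sign of parity everywhere, hence nonzero
correlation with it. But parity is orthogonal to every function missing some bit, so the degree is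
at least `n - 1` (`le_degree_add_one_of_represents`). -/

namespace ParityAttention

open Finset

/-! ### Degree of functions and of quotients with a common denominator -/

section LowDegree

variable {ι α : Type*}

/-- The span of the functions that depend on the coordinates in `T` and at most `D` others. -/
def lowDegree (T : Set ι) (D : ℕ) : Submodule ℝ ((ι → α) → ℝ) :=
  Submodule.span ℝ {g | ∃ S : Finset ι, S.card ≤ D ∧ DependsOn g (T ∪ (S : Set ι))}

variable {T : Set ι} {D E : ℕ}

theorem lowDegree_mono (h : D ≤ E) :
    lowDegree (α := α) T D ≤ lowDegree T E :=
  Submodule.span_mono fun _ ⟨S, hS, hg⟩ => ⟨S, hS.trans h, hg⟩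

theorem mem_lowDegree_of_dependsOn {g : (ι → α) → ℝ} (S : Finset ι) (hS : S.card ≤ D)
    (hg : DependsOn g (T ∪ (S : Set ι))) : g ∈ lowDegree T D :=
  Submodule.subset_span ⟨S, hS, hg⟩

theorem const_mem_lowDegree (c : ℝ) : (fun _ => c) ∈ lowDegree (α := α) T D :=
  mem_lowDegree_of_dependsOn ∅ (by simp) fun _ _ _ => rfl

theorem mul_mem_lowDegree {f g : (ι → α) → ℝ} (hf : f ∈ lowDegree T D)
    (hg : g ∈ lowDegree T E) : f * g ∈ lowDegree T (D + E) := by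
  classical
  have h := Submodule.mul_mem_mul hf hg
  rw [lowDegree, lowDegree, Submodule.span_mul_span] at h
  refine Submodule.span_mono ?_ h
  rintro _ ⟨a, ⟨S, hS, ha⟩, b, ⟨S', hS', hb⟩, rfl⟩
  refine ⟨S ∪ S', (card_union_le _ _).trans (add_le_add hS hS'), fun x y hxy => ?_⟩
  have h1 := ha (x := x) (y := y) fun i hi => hxy i (by
    rcases hi with hi | hi
    · exact Or.inl hi
    · right; simp only [coe_union]; exact Or.inl hi)
  have h2 := hb (x := x) (y := y) fun i hi => hxy i (by
    rcases hi with hi | hi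
    · exact Or.inl hi
    · right; simp only [coe_union]; exact Or.inr hi)
  simp only [Pi.mul_apply, h1, h2]

theorem prod_mem_lowDegree {κ : Type*} (s : Finset κ) {f : κ → (ι → α) → ℝ}
    (hf : ∀ k ∈ s, f k ∈ lowDegree T D) : ∏ k ∈ s, f k ∈ lowDegree T (s.card * D) := by
  classical
  induction s using Finset.induction_on with
  | empty => exact const_mem_lowDegree 1
  | insert a s ha ih =>
    rw [prod_insert ha, card_insert_of_notMem ha, add_mul, one_mul, add_comm]
    exact mul_mem_lowDegree (hf a (mem_insert_self _ _))
      (ih fun k hk => hf k (mem_insert_of_mem hk))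

/-- The functions `F k` are quotients of functions of degree at most `D` with one common positive
denominator. -/
def HasCommonDenominator {κ : Type*} (T : Set ι) (D : ℕ) (F : κ → (ι → α) → ℝ) : Prop :=
  ∃ Q ∈ lowDegree (α := α) T D, (∀ x, 0 < Q x) ∧
    ∀ k, ∃ P ∈ lowDegree (α := α) T D, ∀ x, F k x = P x / Q x

namespace HasCommonDenominator

theorem affine {κ κ' : Type*} [Fintype κ] {F : κ → (ι → α) → ℝ}
    (hF : HasCommonDenominator T D F) (a : κ' → κ → ℝ) (b : κ' → ℝ) :
    HasCommonDenominator T D fun k' x => ∑ k, a k' k * F k x + b k' := by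
  obtain ⟨Q, hQ, hpos, hP⟩ := hF
  choose P hP hFP using hP
  refine ⟨Q, hQ, hpos, fun k' => ⟨∑ k, a k' k • P k + b k' • Q,
    add_mem (sum_mem fun k _ => Submodule.smul_mem _ _ (hP k)) (Submodule.smul_mem _ _ hQ),
    fun x => ?_⟩⟩
  have := (hpos x).ne'
  simp only [hFP, Pi.add_apply, Finset.sum_apply, Pi.smul_apply, smul_eq_mul, add_div, sum_div]
  congr 1
  · exact sum_congr rfl fun k _ => by ring
  · field_simp

/-- Take the product of all denominators and multiply each numerator by the other ones. This is
where the number of heads and the width of a layer enter the degree. -/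
theorem prod {κ κ' : Type*} [Fintype κ'] {F : κ' → κ → (ι → α) → ℝ}
    (hF : ∀ j, HasCommonDenominator T D (F j)) :
    HasCommonDenominator T (Fintype.card κ' * D) fun p : κ' × κ => F p.1 p.2 := by
  classical
  choose Q hQ hpos hP using hF
  choose P hP hFP using hP
  refine ⟨∏ j, Q j, prod_mem_lowDegree _ fun j _ => hQ j, fun x => ?_, fun p =>
    ⟨P p.1 p.2 * ∏ j ∈ univ.erase p.1, Q j, ?_, fun x => ?_⟩⟩
  · rw [Finset.prod_apply]
    exact prod_pos fun j _ => hpos j x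
  · have h := mul_mem_lowDegree (hP p.1 p.2)
      (prod_mem_lowDegree (univ.erase p.1) fun j _ => hQ j)
    refine lowDegree_mono (le_of_eq ?_) h
    have h1 : (univ.erase p.1).card + 1 = Fintype.card κ' := by
      rw [card_erase_add_one (mem_univ _), card_univ]
    rw [← h1]; ring
  · beta_reduce
    rw [hFP, ← mul_prod_erase univ Q (mem_univ p.1)]
    have h1 : (∏ j ∈ univ.erase p.1, Q j) x ≠ 0 := by
      rw [Finset.prod_apply]
      exact (prod_pos fun j _ => hpos j x).ne'
    rw [Pi.mul_apply, Pi.mul_apply, mul_div_mul_right _ _ h1]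

theorem mono {κ : Type*} {F : κ → (ι → α) → ℝ} (hF : HasCommonDenominator T D F) (h : D ≤ E) :
    HasCommonDenominator T E F := by
  obtain ⟨Q, hQ, hpos, hP⟩ := hF
  refine ⟨Q, lowDegree_mono h hQ, hpos, fun k => ?_⟩
  obtain ⟨P, hP, hFP⟩ := hP k
  exact ⟨P, lowDegree_mono h hP, hFP⟩

end HasCommonDenominator

end LowDegree

/-! ### Newman's rational approximation of ReLU -/

section Newman

/-- Newman's polynomial with the nodes `-1, -ξ, …, -ξ ^ (N - 1)`. -/
def newmanPoly (ξ : ℝ) (N : ℕ) (t : ℝ) : ℝ := ∏ k ∈ range N, (t + ξ ^ k)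

/-- Newman's rational approximation of the rectified linear unit, with squares. -/
noncomputable def newmanRelu (ξ : ℝ) (N : ℕ) (t : ℝ) : ℝ :=
  t * (newmanPoly ξ N t ^ 2 / (newmanPoly ξ N t ^ 2 + newmanPoly ξ N (-t) ^ 2))

variable {ξ : ℝ} {N : ℕ}

theorem newmanPoly_pos (hξ : 0 < ξ) {t : ℝ} (ht : 0 ≤ t) : 0 < newmanPoly ξ N t :=
  prod_pos fun _ _ => by positivity

theorem newman_denom_pos (hξ : 0 < ξ) (t : ℝ) :
    0 < newmanPoly ξ N t ^ 2 + newmanPoly ξ N (-t) ^ 2 := by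
  rcases le_total 0 t with h | h
  · have := newmanPoly_pos (N := N) hξ h
    positivity
  · have := newmanPoly_pos (N := N) hξ (neg_nonneg.2 h)
    positivity

/-- The squares put the factor multiplying `t` in `[0, 1]`; thus approximate gates never leave `[-1,
1]`. -/
theorem abs_newmanRelu_le (t : ℝ) : |newmanRelu ξ N t| ≤ |t| := by
  rw [newmanRelu, abs_mul]
  refine mul_le_of_le_one_right (abs_nonneg t) ?_
  rw [abs_of_nonneg (by positivity)]
  exact div_le_one_of_le₀ (le_add_of_nonneg_right (sq_nonneg _)) (by positivity)

theorem one_sub_le_one_add_mul_exp {s : ℝ} (h0 : 0 ≤ s) (h1 : s ≤ 1) :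
    1 - s ≤ (1 + s) * Real.exp (-2 * s) := by
  rcases h1.eq_or_lt with rfl | h1
  · rw [sub_self]; positivity
  have hs : 0 < 1 - s := by linarith
  -- At this point the bound `2x / (x + 2) ≤ log (1 + x)` reads `2s ≤ log ((1 + s) / (1 - s))`.
  have h := Real.le_log_one_add_of_nonneg (x := 2 * s / (1 - s)) (by positivity)
  have e1 : 2 * (2 * s / (1 - s)) / (2 * s / (1 - s) + 2) = 2 * s := by
    field_simp
    ring
  have e2 : 1 + 2 * s / (1 - s) = (1 + s) / (1 - s) := by
    field_simp
    ring
  rw [e1, e2, Real.le_log_iff_exp_le (by positivity), le_div_iff₀ hs] at h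
  calc 1 - s = Real.exp (2 * s) * (1 - s) * Real.exp (-2 * s) := by
        rw [mul_right_comm, ← Real.exp_add]; simp
    _ ≤ _ := by gcongr

theorem abs_sub_le_add_mul_exp {x y c : ℝ} (hx : 0 < x) (hxy : x ≤ y) (hc : c * y ≤ x) :
    |x - y| ≤ (x + y) * Real.exp (-2 * c) := by
  have hy := hx.trans_le hxy
  have h := one_sub_le_one_add_mul_exp (s := x / y) (by positivity) ((div_le_one hy).2 hxy)
  rw [abs_sub_comm, abs_of_nonneg (by linarith)]
  calc y - x = y * (1 - x / y) := by field_simp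
    _ ≤ y * ((1 + x / y) * Real.exp (-2 * (x / y))) := by gcongr
    _ = (x + y) * Real.exp (-2 * (x / y)) := by field_simp; ring
    _ ≤ _ := by
      have : c ≤ x / y := (le_div_iff₀ hy).2 hc
      gcongr (x + y) * Real.exp ?_
      linarith

theorem abs_newmanPoly_neg_le (hξ : 0 < ξ) (hξ1 : ξ < 1) {x : ℝ} (hx : ξ ^ N < x) (hx1 : x ≤ 1) :
    |newmanPoly ξ N (-x)| ≤
      newmanPoly ξ N x * Real.exp (-2 * ∑ k ∈ range N, ξ ^ (k + 1)) := by
  have hx0 : 0 < x := lt_trans (by positivity) hx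
  obtain ⟨j, hj, hj'⟩ := exists_nat_pow_near_of_lt_one hx0 hx1 hξ hξ1
  have hjN : j + 1 ≤ N := by
    by_contra! hlt
    have : ξ ^ j ≤ ξ ^ N := pow_le_pow_of_le_one hξ.le hξ1.le (by omega)
    linarith
  obtain ⟨M, rfl⟩ := Nat.exists_eq_add_of_le hjN
  set c : ℕ → ℝ := fun k => if k ≤ j then ξ ^ (j - k + 1) else ξ ^ (k + 1) with hc
  -- Here `ξ ^ (j + 1) < x ≤ ξ ^ j`, and `c k` bounds from below the ratio of the smaller to the
  -- larger of `x` and `ξ ^ k`. The exponents in `c` permute `1, …, N`, so the sum does not depend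
  -- on `j`.
  have hfac : ∀ k, |-x + ξ ^ k| ≤ (x + ξ ^ k) * Real.exp (-2 * c k) := by
    intro k
    rw [neg_add_eq_sub, abs_sub_comm]
    simp only [hc]
    split_ifs with hk
    · refine abs_sub_le_add_mul_exp hx0 (hj'.trans (pow_le_pow_of_le_one hξ.le hξ1.le hk)) ?_
      rw [← pow_add, show j - k + 1 + k = j + 1 by omega]
      exact hj.le
    · rw [abs_sub_comm, add_comm x]
      refine abs_sub_le_add_mul_exp (by positivity)
        ((pow_le_pow_of_le_one hξ.le hξ1.le (by omega : j + 1 ≤ k)).trans hj.le) ?_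
      calc ξ ^ (k + 1) * x ≤ ξ ^ (k + 1) * 1 := by gcongr
        _ ≤ ξ ^ k := by
          rw [mul_one]; exact pow_le_pow_of_le_one hξ.le hξ1.le (by omega)
  have hsum : ∑ k ∈ range (j + 1 + M), c k = ∑ k ∈ range (j + 1 + M), ξ ^ (k + 1) := by
    rw [sum_range_add c, sum_range_add fun k => ξ ^ (k + 1)]
    congr 1
    · rw [← sum_range_reflect (fun k => ξ ^ (k + 1))]
      refine sum_congr rfl fun k hk => ?_
      have := mem_range.1 hk
      simp only [hc]
      rw [if_pos (by omega)]
      congr 1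
    · refine sum_congr rfl fun k hk => ?_
      simp only [hc]
      rw [if_neg (by omega)]
  rw [newmanPoly, abs_prod, ← hsum, mul_sum, Real.exp_sum, newmanPoly, ← prod_mul_distrib]
  exact prod_le_prod (fun _ _ => abs_nonneg _) fun k _ => hfac k

/-- With `y = |x|` and `p = newmanPoly ξ N`, the error is `y * p(-y)² / (p(y)² + p(-y)²)`. For `y ≤
ξ ^ N` the factor `y` is small enough; beyond that the squared ratio `p(-y) / p(y)` is. -/
theorem abs_newmanRelu_sub_relu_le (hξ : 0 < ξ) (hξ1 : ξ < 1) {δ : ℝ} (hN : ξ ^ N ≤ δ)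
    (hδ : Real.exp (-4 * ∑ k ∈ range N, ξ ^ (k + 1)) ≤ δ) {x : ℝ} (hx : |x| ≤ 1) :
    |newmanRelu ξ N x - relu x| ≤ δ := by
  have hδ0 : 0 < δ := (Real.exp_pos _).trans_le hδ
  have key : ∀ y : ℝ, 0 ≤ y → y ≤ 1 → y * (newmanPoly ξ N (-y) ^ 2 /
      (newmanPoly ξ N y ^ 2 + newmanPoly ξ N (-y) ^ 2)) ≤ δ := by
    intro y hy hy1
    have hp := newmanPoly_pos (N := N) hξ hy
    rcases le_or_gt y (ξ ^ N) with h | h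
    · refine (mul_le_of_le_one_right hy ?_).trans (h.trans hN)
      exact div_le_one_of_le₀ (le_add_of_nonneg_left (sq_nonneg _)) (by positivity)
    · have h1 := abs_newmanPoly_neg_le hξ hξ1 h hy1
      have h2 : newmanPoly ξ N (-y) ^ 2 ≤ newmanPoly ξ N y ^ 2 * δ := by
        rw [← sq_abs (newmanPoly ξ N (-y))]
        calc |newmanPoly ξ N (-y)| ^ 2
            ≤ (newmanPoly ξ N y * Real.exp (-2 * ∑ k ∈ range N, ξ ^ (k + 1))) ^ 2 := by gcongr
          _ = newmanPoly ξ N y ^ 2 * Real.exp (-4 * ∑ k ∈ range N, ξ ^ (k + 1)) := by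
            rw [mul_pow, ← Real.exp_nat_mul]; congr 2; push_cast; ring
          _ ≤ _ := by gcongr
      refine (mul_le_of_le_one_left (by positivity) hy1).trans ?_
      rw [div_le_iff₀ (by positivity)]
      nlinarith [sq_nonneg (newmanPoly ξ N (-y))]
  have hd := newman_denom_pos (N := N) hξ x
  rw [abs_le] at hx
  rcases le_total 0 x with h | h
  · have e : newmanRelu ξ N x - relu x = -(x * (newmanPoly ξ N (-x) ^ 2 /
        (newmanPoly ξ N x ^ 2 + newmanPoly ξ N (-x) ^ 2))) := by
      rw [newmanRelu, relu, max_eq_right h]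
      field_simp
      ring
    rw [e, abs_neg, abs_of_nonneg (by positivity)]
    exact key x h hx.2
  · have e : newmanRelu ξ N x - relu x = -(-x * (newmanPoly ξ N (- -x) ^ 2 /
        (newmanPoly ξ N (-x) ^ 2 + newmanPoly ξ N (- -x) ^ 2))) := by
      rw [newmanRelu, relu, max_eq_left h, neg_neg, add_comm (newmanPoly ξ N (-x) ^ 2)]
      ring
    have h' : 0 ≤ -x := by linarith
    rw [e, abs_neg, abs_of_nonneg (by positivity)]
    exact key (-x) h' (by linarith)

/-- The rectified linear unit is approximated on `[-1, 1]` within `exp (-L)` by a Newman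
approximation of degree at most `L ^ 2`. -/
theorem exists_newmanRelu_approx {L : ℝ} (hL : 30 ≤ L) :
    ∃ (ξ : ℝ) (N : ℕ), 0 < ξ ∧ ((2 * N + 1 : ℕ) : ℝ) ≤ L ^ 2 ∧
      ∀ x, |x| ≤ 1 → |newmanRelu ξ N x - relu x| ≤ Real.exp (-L) := by
  have hL0 : 0 < L := by linarith
  -- These choices give `ξ ^ N ≤ exp (-L)` and `2N + 1 ≤ 2L²/3 + 3 ≤ L²`. The geometric sum is at
  -- least `(27/31) * (L/3)`, and four times this exceeds `L`.
  set ξ := Real.exp (-(3 / L)) with hξ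
  set N := ⌈L ^ 2 / 3⌉₊ with hN
  have hξ0 : 0 < ξ := Real.exp_pos _
  have h3 : 0 < 3 / L := by positivity
  have h3' : 3 / L ≤ 1 / 10 := by rw [div_le_iff₀ hL0]; linarith
  have hξ1 : ξ < 1 := by rw [hξ, Real.exp_lt_one_iff]; linarith
  have hξge : 1 - 3 / L ≤ ξ := by have := Real.add_one_le_exp (-(3 / L)); linarith
  have hNge : L ^ 2 / 3 ≤ N := Nat.le_ceil _
  have hNle : (N : ℝ) < L ^ 2 / 3 + 1 := Nat.ceil_lt_add_one (by positivity)
  have hpow : ξ ^ N ≤ Real.exp (-L) := by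
    rw [hξ, ← Real.exp_nat_mul, Real.exp_le_exp]
    have : L = L ^ 2 / 3 * (3 / L) := by field_simp
    nlinarith
  refine ⟨ξ, N, hξ0, by push_cast; nlinarith, fun x hx =>
    abs_newmanRelu_sub_relu_le hξ0 hξ1 hpow ?_ hx⟩
  rw [Real.exp_le_exp]
  set G := ∑ k ∈ range N, ξ ^ (k + 1) with hG
  have hgeom : G * (1 - ξ) = ξ * (1 - ξ ^ N) := by
    have := geom_sum_mul_neg ξ N
    rw [hG, ← this]
    simp only [pow_succ', ← mul_sum]
    ring
  have hG0 : 0 ≤ G := sum_nonneg fun _ _ => by positivity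
  have hsmall : Real.exp (-L) ≤ 1 / 31 := by
    rw [Real.exp_neg, inv_eq_one_div]
    refine one_div_le_one_div_of_le (by norm_num) ?_
    have := Real.add_one_le_exp L
    linarith
  have h5 : 27 / 31 ≤ G * (3 / L) := by
    calc (27 / 31 : ℝ) = 9 / 10 * (30 / 31) := by norm_num
      _ ≤ ξ * (1 - ξ ^ N) := by
        refine mul_le_mul (by linarith) (by linarith) (by norm_num) hξ0.le
      _ = G * (1 - ξ) := hgeom.symm
      _ ≤ G * (3 / L) := by gcongr; linarith
  rw [← mul_div_assoc, le_div_iff₀ hL0] at h5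
  linarith

theorem HasCommonDenominator.newmanRelu {ι α : Type*} {T : Set ι} {D : ℕ} (hξ : 0 < ξ)
    {f : (ι → α) → ℝ} (hf : HasCommonDenominator T D fun _ : Unit => f) :
    HasCommonDenominator T ((2 * N + 1) * D) fun _ : Unit => fun x => newmanRelu ξ N (f x) := by
  obtain ⟨Q, hQ, hpos, hP⟩ := hf
  obtain ⟨P, hP, hfP⟩ := hP ()
  -- Homogenization: `p` and `q` are `Q ^ N` times Newman's polynomial at `± P / Q`.
  set p : (ι → α) → ℝ := ∏ k ∈ range N, (P + ξ ^ k • Q) with hp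
  set q : (ι → α) → ℝ := ∏ k ∈ range N, (-P + ξ ^ k • Q) with hq
  have hpmem : p ∈ lowDegree T (N * D) := by
    simpa using prod_mem_lowDegree (range N) (f := fun k => P + ξ ^ k • Q)
      fun k _ => add_mem hP (Submodule.smul_mem _ _ hQ)
  have hqmem : q ∈ lowDegree T (N * D) := by
    simpa using prod_mem_lowDegree (range N) (f := fun k => -P + ξ ^ k • Q)
      fun k _ => add_mem (neg_mem hP) (Submodule.smul_mem _ _ hQ)
  have hpx : ∀ x, p x = Q x ^ N * newmanPoly ξ N (f x) := by
    intro x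
    have := (hpos x).ne'
    rw [hp, Finset.prod_apply, newmanPoly, ← card_range N, ← prod_const, card_range,
      ← prod_mul_distrib]
    refine prod_congr rfl fun k _ => ?_
    simp only [Pi.add_apply, Pi.smul_apply, smul_eq_mul, hfP]
    field_simp
  have hqx : ∀ x, q x = Q x ^ N * newmanPoly ξ N (-f x) := by
    intro x
    have := (hpos x).ne'
    rw [hq, Finset.prod_apply, newmanPoly, ← card_range N, ← prod_const, card_range,
      ← prod_mul_distrib]
    refine prod_congr rfl fun k _ => ?_
    simp only [Pi.add_apply, Pi.neg_apply, Pi.smul_apply, smul_eq_mul, hfP]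
    field_simp
  have hdeg : D + (N * D + N * D) = (2 * N + 1) * D := by ring
  have hx : ∀ x, p x * p x + q x * q x = Q x ^ (2 * N) *
      (newmanPoly ξ N (f x) ^ 2 + newmanPoly ξ N (-f x) ^ 2) := by
    intro x
    rw [hpx, hqx]
    ring
  refine ⟨Q * (p * p + q * q), ?_, fun x => ?_, fun _ => ⟨P * (p * p), ?_, fun x => ?_⟩⟩
  · rw [← hdeg]
    exact mul_mem_lowDegree hQ (add_mem (mul_mem_lowDegree hpmem hpmem)
      (mul_mem_lowDegree hqmem hqmem))
  · simp only [Pi.mul_apply, Pi.add_apply, hx]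
    exact mul_pos (hpos x) (mul_pos (pow_pos (hpos x) _) (newman_denom_pos hξ _))
  · rw [← hdeg]
    exact mul_mem_lowDegree hP (mul_mem_lowDegree hpmem hpmem)
  · have h1 := (hpos x).ne'
    have h2 := (newman_denom_pos (N := N) hξ (f x)).ne'
    simp only [Pi.mul_apply, Pi.add_apply, hx]
    rw [ParityAttention.newmanRelu, hpx]
    rw [show P x = f x * Q x by rw [show f x = P x / Q x from hfP x]; field_simp]
    field_simp
    ring

end Newman

/-! ### Replacing the gates of a network by rational functions -/

section Network

theorem abs_relu_sub_relu_le (s t : ℝ) : |relu s - relu t| ≤ |s - t| :=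
  abs_max_sub_max_le_max 0 s 0 t |>.trans (by simp)

theorem NormalizedAffine.abs_eval_sub_le {w : ℕ} (g : NormalizedAffine w) {z z' : Fin w → ℝ}
    {δ : ℝ} (hδ : 0 ≤ δ) (h : ∀ i, |z i - z' i| ≤ δ) : |g.eval z - g.eval z'| ≤ δ := by
  have e : g.eval z - g.eval z' = ∑ i, g.a i * (z i - z' i) := by
    simp only [NormalizedAffine.eval, mul_sub, sum_sub_distrib]
    ring
  rw [e]
  calc |∑ i, g.a i * (z i - z' i)| ≤ ∑ i, |g.a i| * δ :=
        (abs_sum_le_sum_abs _ _).trans (sum_le_sum fun i _ => by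
          rw [abs_mul]; exact mul_le_mul_of_nonneg_left (h i) (abs_nonneg _))
    _ = (∑ i, |g.a i|) * δ := by rw [sum_mul]
    _ ≤ 1 * δ := by
      have := g.norm_le
      have := abs_nonneg g.b
      gcongr
      linarith
    _ = δ := one_mul δ

theorem NormalizedAffine.abs_eval_le {w : ℕ} (g : NormalizedAffine w) {z : Fin w → ℝ}
    (h : ∀ i, |z i| ≤ 1) : |g.eval z| ≤ 1 := by
  calc |g.eval z| ≤ ∑ i, |g.a i| + |g.b| := by
        refine (abs_add_le _ _).trans ?_
        gcongr
        refine (abs_sum_le_sum_abs _ _).trans (sum_le_sum fun i _ => ?_)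
        rw [abs_mul]
        exact mul_le_of_le_one_right (abs_nonneg _) (h i)
    _ ≤ 1 := g.norm_le

theorem HasCommonDenominator.normalizedAffine {ι α : Type*} {T : Set ι} {D w : ℕ}
    {F : Fin w → (ι → α) → ℝ} (hF : HasCommonDenominator T D F) (g : NormalizedAffine w) :
    HasCommonDenominator T D fun _ : Unit => fun x => g.eval fun i => F i x :=
  hF.affine (fun _ => g.a) fun _ => g.b

/-- Affine forms and ReLU are 1-Lipschitz in the sup norm, so each layer adds only `ε`. The
invariant `|F i x| ≤ 1` keeps gate arguments where `happ` applies. -/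
theorem ReLULayers.exists_approx {ι α : Type*} {T : Set ι} {D d m : ℕ} {ξ ε : ℝ} {N : ℕ}
    (hξ : 0 < ξ) (hε : 0 ≤ ε) (happ : ∀ x, |x| ≤ 1 → |newmanRelu ξ N x - relu x| ≤ ε)
    {Y : Fin d → (ι → α) → ℝ} (hY : HasCommonDenominator T D Y) (hY1 : ∀ k x, |Y k x| ≤ 1) :
    ∀ {k w : ℕ} (S : ReLULayers d m k w), ∃ F : Fin w → (ι → α) → ℝ,
      HasCommonDenominator T (D * ((2 * N + 1) * m) ^ k) F ∧ (∀ i x, |F i x| ≤ 1) ∧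
        ∀ i x, |F i x - S.eval (fun j => Y j x) i| ≤ k * ε := by
  intro k w S
  induction S with
  | input => exact ⟨Y, by simpa using hY, hY1, fun i x => by simp [ReLULayers.eval]⟩
  | @layer k w S w' hw gate ih =>
    obtain ⟨F, hF, hF1, hFS⟩ := ih
    refine ⟨fun i x => newmanRelu ξ N ((gate i).eval fun j => F j x), ?_, fun i x => ?_,
      fun i x => ?_⟩
    · have h1 := HasCommonDenominator.prod fun i =>
        HasCommonDenominator.newmanRelu (N := N) hξ (hF.normalizedAffine (gate i))
      obtain ⟨Q, hQ, hpos, hP⟩ := h1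
      refine HasCommonDenominator.mono ⟨Q, hQ, hpos, fun i => hP (i, ())⟩ ?_
      rw [Fintype.card_fin, pow_succ]
      calc w' * ((2 * N + 1) * (D * ((2 * N + 1) * m) ^ k))
          ≤ m * ((2 * N + 1) * (D * ((2 * N + 1) * m) ^ k)) := by gcongr
        _ = _ := by ring
    · exact (abs_newmanRelu_le _).trans ((gate i).abs_eval_le fun j => hF1 j x)
    · have h1 := happ _ ((gate i).abs_eval_le fun j => hF1 j x)
      have h2 := (gate i).abs_eval_sub_le (δ := k * ε) (by positivity) fun j => hFS j x
      have h3 := abs_relu_sub_relu_le ((gate i).eval fun j => F j x)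
        ((gate i).eval (S.eval fun j => Y j x))
      have h4 := abs_sub_le (newmanRelu ξ N ((gate i).eval fun j => F j x))
        (relu ((gate i).eval fun j => F j x)) (relu ((gate i).eval (S.eval fun j => Y j x)))
      simp only [ReLULayers.eval]
      push_cast
      linarith

end Network

/-! ### Attention heads as quotients of low degree -/

section Attention

variable {n d h : ℕ} [NeZero n]

theorem SelfAttentionHead.weight_pos (A : SelfAttentionHead n d) (x : Fin n → Fin 2)
    (i : Fin n) : 0 < A.weight x i := Real.exp_pos _

theorem SelfAttentionHead.weight_mul_mem_lowDegree (A : SelfAttentionHead n d) (i : Fin n)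
    (v : Fin 2 → ℝ) : (fun x => A.weight x i * v (x i)) ∈ lowDegree {lastIdx n} 1 := by
  refine mem_lowDegree_of_dependsOn {i} (by simp) fun x y hxy => ?_
  have h1 := hxy (lastIdx n) (by simp)
  have h2 := hxy i (by simp)
  simp only [SelfAttentionHead.weight, h1, h2]

theorem SelfAttentionHead.hasCommonDenominator (A : SelfAttentionHead n d) :
    HasCommonDenominator {lastIdx n} 1 fun (k : Fin d) x => A.eval x k := by
  refine ⟨∑ i, fun x => A.weight x i * 1, sum_mem fun i _ =>
    A.weight_mul_mem_lowDegree i fun _ => 1, fun x => ?_, fun k =>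
    ⟨∑ i, fun x => A.weight x i * A.value i (x i) k, sum_mem fun i _ =>
      A.weight_mul_mem_lowDegree i fun b => A.value i b k, fun x => ?_⟩⟩
  · rw [Finset.sum_apply]
    exact sum_pos (fun i _ => by simpa using A.weight_pos x i) ⟨lastIdx n, mem_univ _⟩
  · simp [SelfAttentionHead.eval, Finset.sum_apply, div_eq_inv_mul]

theorem headSum_hasCommonDenominator (A : Fin h → SelfAttentionHead n d) :
    HasCommonDenominator {lastIdx n} h fun (k : Fin d) x => headSum A x k := by
  -- Coordinate `k` of the sum is a 0/1 combination of the pairs (head, coordinate).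
  have h1 := (HasCommonDenominator.prod fun j => (A j).hasCommonDenominator).affine
    (fun (k : Fin d) p => if p.2 = k then 1 else 0) fun _ => 0
  rw [Fintype.card_fin, mul_one] at h1
  convert h1 using 3 with k x
  simp [headSum, Fintype.sum_prod_type]

end Attention

/-! ### Parity against functions of low degree -/

section Parity

/-- The `±1`-valued parity character. -/
def paritySign {n : ℕ} (x : Fin n → Fin 2) : ℝ := ∏ i, (-1) ^ (x i : ℕ)

theorem paritySign_eq {n : ℕ} (x : Fin n → Fin 2) :
    paritySign x = if parity n x = 1 then -1 else 1 := by
  rw [paritySign, prod_pow_eq_pow_sum, parity]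
  split_ifs with h1 h2 h2
  · exact h1.neg_one_pow
  · exact absurd rfl h2
  · exact absurd h2 (by decide)
  · exact (Nat.not_odd_iff_even.1 h1).neg_one_pow

/-- Flipping bit `i` negates the sign and fixes `g`, so the terms cancel in pairs. -/
theorem sum_paritySign_mul_eq_zero_of_dependsOn {n : ℕ} {g : (Fin n → Fin 2) → ℝ}
    {s : Set (Fin n)} (hg : DependsOn g s) {i : Fin n} (hi : i ∉ s) :
    ∑ x, paritySign x * g x = 0 := by
  have hinv : ∀ x : Fin n → Fin 2, Function.update (Function.update x i (1 - x i)) i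
      (1 - Function.update x i (1 - x i) i) = x := by
    intro x
    simp
  refine sum_involution (fun x _ => Function.update x i (1 - x i)) ?_ ?_ ?_ ?_
  · intro x _
    have h1 : g (Function.update x i (1 - x i)) = g x :=
      hg fun j hj => Function.update_of_ne (fun e : j = i => hi (e ▸ hj)) _ _
    have h2 : paritySign (Function.update x i (1 - x i)) = -paritySign x := by
      rw [paritySign, paritySign, ← mul_prod_erase _ _ (mem_univ i),
        ← mul_prod_erase univ (fun j => (-1 : ℝ) ^ (x j : ℕ)) (mem_univ i),
        Function.update_self, ← neg_mul]
      congr 1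
      · generalize x i = b
        fin_cases b <;> simp
      · exact prod_congr rfl fun j hj => by rw [Function.update_of_ne (ne_of_mem_erase hj)]
    rw [h1, h2]
    ring
  · intro x _ _ h
    have := congrFun h i
    rw [Function.update_self] at this
    revert this
    generalize x i = b
    fin_cases b <;> simp
  · simp
  · exact fun x _ => hinv x

theorem sum_paritySign_mul_eq_zero {n D : ℕ} {t : Fin n} (hD : D + 1 < n)
    {f : (Fin n → Fin 2) → ℝ} (hf : f ∈ lowDegree {t} D) : ∑ x, paritySign x * f x = 0 := by
  induction hf using Submodule.span_induction with
  | mem g hg =>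
    obtain ⟨S, hS, hg⟩ := hg
    obtain ⟨i, hi⟩ : ∃ i, i ∉ insert t S := by
      by_contra! hall
      have h1 : (univ : Finset (Fin n)).card ≤ (insert t S).card :=
        card_le_card fun i _ => hall i
      have h2 := card_insert_le t S
      simp only [card_univ, Fintype.card_fin] at h1
      omega
    exact sum_paritySign_mul_eq_zero_of_dependsOn hg (i := i) (by simpa using hi)
  | zero => simp
  | add f g _ _ hf hg => simp only [Pi.add_apply, mul_add, sum_add_distrib, hf, hg, add_zero]
  | smul c f _ hf =>
    simp only [Pi.smul_apply, smul_eq_mul, mul_left_comm _ c, ← mul_sum, hf, mul_zero]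

theorem le_degree_add_one_of_represents {n D : ℕ} {t : Fin n} {f g : (Fin n → Fin 2) → ℝ}
    {τ γ : ℝ} (hf : HasCommonDenominator {t} D fun _ : Unit => f)
    (hg : Represents τ γ g (parity n)) (hfg : ∀ x, |f x - g x| < γ) : n ≤ D + 1 := by
  by_contra! hD
  obtain ⟨Q, hQ, hpos, hP⟩ := hf
  obtain ⟨P, hP, hfP⟩ := hP ()
  have h0 := sum_paritySign_mul_eq_zero hD (sub_mem hP (Submodule.smul_mem _ τ hQ))
  refine absurd h0 (ne_of_lt ?_)
  refine sum_neg (fun x _ => ?_) ⟨0, mem_univ _⟩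
  have e : (P - τ • Q) x = Q x * (f x - τ) := by
    have := (hpos x).ne'
    simp only [Pi.sub_apply, Pi.smul_apply, smul_eq_mul, hfP]
    field_simp
  have h1 := abs_lt.1 (hfg x)
  rw [e, paritySign_eq]
  split_ifs with hx
  · have := (hg x).1 hx
    nlinarith [mul_pos (hpos x) (show 0 < f x - τ by linarith)]
  · have hx0 : parity n x = 0 := by
      generalize parity n x = b at hx
      fin_cases b <;> simp_all
    have := (hg x).2 hx0
    nlinarith [mul_pos (hpos x) (show 0 < τ - f x by linarith)]

/-- Excludes `h = 0` and `m = 0`, where the claimed lower bound would fail. -/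
theorem not_represents_parity_const {n : ℕ} [NeZero n] {τ γ c : ℝ} (hγ : 0 < γ)
    {f : (Fin n → Fin 2) → ℝ} (hf : ∀ x, f x = c) : ¬ Represents τ γ f (parity n) := by
  intro hrep
  have h1 := (hrep 0).2 (by simp [parity])
  have h2 := (hrep (Pi.single (lastIdx n) 1)).1 (by
    rw [parity, if_pos]
    rw [sum_eq_single (lastIdx n) (fun i _ hi => by simp [Pi.single_eq_of_ne hi]) (by simp)]
    simp)
  rw [hf] at h1 h2
  linarith

end Parity

/-! ### Assembling the bound -/

theorem ReLULayers.width_eq_zero {d k w : ℕ} (hk : 1 ≤ k) (S : ReLULayers d 0 k w) :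
    w = 0 := by
  cases S with
  | input => omega
  | layer S w' hw gate => omega

/-- The approximation needs `L ≥ 30`. Smaller `L` forces `ℓ ≤ exp 30`, so raising `L ≥ log 2` to 30
costs only a constant factor. -/
theorem sq_pow_max_le {L : ℝ} {ℓ : ℕ} (hℓ : 1 ≤ ℓ) (hL : Real.log (2 * ℓ) ≤ L) :
    (max L 30) ^ (2 * ℓ) ≤ (30 / Real.log 2) ^ (2 * ⌈Real.exp 30⌉₊) * L ^ (2 * ℓ) := by
  have hlog2 : 0 < Real.log 2 := Real.log_pos (by norm_num)
  have hℓ' : (1 : ℝ) ≤ ℓ := by exact_mod_cast hℓ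
  have hL2 : Real.log 2 ≤ L :=
    (Real.log_le_log (by norm_num) (by linarith)).trans hL
  have hL0 : 0 < L := hlog2.trans_le hL2
  have hK : 1 ≤ 30 / Real.log 2 := by
    rw [le_div_iff₀ hlog2]
    have := Real.log_two_lt_d9
    linarith
  rcases le_total 30 L with h | h
  · rw [max_eq_left h]
    exact le_mul_of_one_le_left (by positivity) (one_le_pow₀ hK)
  · rw [max_eq_right h]
    have hle : ℓ ≤ ⌈Real.exp 30⌉₊ := by
      have h1 : (2 * ℓ : ℝ) ≤ Real.exp 30 := by
        rw [← Real.log_le_iff_le_exp (by positivity)]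
        exact hL.trans h
      have h2 : (ℓ : ℝ) ≤ ⌈Real.exp 30⌉₊ := by
        have := Nat.le_ceil (Real.exp 30)
        linarith
      exact_mod_cast h2
    calc (30 : ℝ) ^ (2 * ℓ) = (30 / Real.log 2) ^ (2 * ℓ) * Real.log 2 ^ (2 * ℓ) := by
          rw [← mul_pow]; congr 1; field_simp
      _ ≤ _ := by gcongr

theorem represents_parity_bound {n d h m ℓ : ℕ} [NeZero n] (A : Fin h → SelfAttentionHead n d)
    (u : EuclideanSpace ℝ (Fin d) → ℝ) (N : NormalizedReLUNetwork d m ℓ) {τ γ : ℝ}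
    (hA : ∀ x, headSum A x ∈ cube d) (hu : ∀ y ∈ cube d, u y = N.eval fun k => y k)
    (hγ : 0 < γ) (hγ1 : γ ≤ 1) (hrep : Represents τ γ (attentionLayer A u) (parity n)) :
    (n : ℝ) ≤ 2 * (30 / Real.log 2) ^ (2 * ⌈Real.exp 30⌉₊) *
      (h * (m : ℝ) ^ ℓ * Real.log (2 * ℓ / γ) ^ (2 * ℓ)) := by
  have hℓ : 1 ≤ ℓ := N.one_le_depth.trans N.depth_le
  have hℓ' : (1 : ℝ) ≤ ℓ := by exact_mod_cast hℓ
  have hh : 1 ≤ h := by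
    by_contra! hh
    obtain rfl : h = 0 := by omega
    exact not_represents_parity_const hγ (c := u 0) (fun x => by simp [attentionLayer, headSum])
      hrep
  have hm : 1 ≤ m := by
    by_contra! hm
    obtain rfl : m = 0 := by omega
    refine not_represents_parity_const hγ (c := N.output.b) (fun x => ?_) hrep
    have := ReLULayers.width_eq_zero N.one_le_depth N.layers
    rw [attentionLayer, hu _ (hA x), NormalizedReLUNetwork.eval, NormalizedAffine.eval,
      add_eq_right]
    exact sum_eq_zero fun i _ => absurd i.2 (by omega)
  set L := Real.log (2 * ℓ / γ) with hL
  obtain ⟨ξ, r, hξ, hr, happ⟩ := exists_newmanRelu_approx (le_max_right L 30)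
  have hexp : Real.exp (-max L 30) ≤ γ / (2 * ℓ) := by
    calc Real.exp (-max L 30) ≤ Real.exp (-L) := by gcongr; exact le_max_left _ _
      _ = γ / (2 * ℓ) := by rw [hL, Real.exp_neg, Real.exp_log (by positivity), inv_div]
  obtain ⟨F, hF, -, hFS⟩ := ReLULayers.exists_approx hξ (Real.exp_pos _).le happ
    (headSum_hasCommonDenominator A) (fun k x => abs_le.2 (hA x k)) N.layers
  have hn : n ≤ h * ((2 * r + 1) * m) ^ N.depth + 1 := by
    refine le_degree_add_one_of_represents (hF.normalizedAffine N.output) hrep fun x => ?_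
    rw [attentionLayer, hu _ (hA x), NormalizedReLUNetwork.eval]
    refine lt_of_le_of_lt
      (N.output.abs_eval_sub_le (by positivity) fun i => hFS i x) ?_
    calc (N.depth : ℝ) * Real.exp (-max L 30) ≤ ℓ * (γ / (2 * ℓ)) := by
          gcongr
          exact N.depth_le
      _ = γ / 2 := by field_simp
      _ < γ := by linarith
  -- The degree is at least 1 since `h, m ≥ 1`, so the factor 2 absorbs the `+ 1`.
  have hn2 : n ≤ 2 * (h * ((2 * r + 1) * m) ^ ℓ) := by
    have h1 : ((2 * r + 1) * m) ^ N.depth ≤ ((2 * r + 1) * m) ^ ℓ :=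
      Nat.pow_le_pow_right (by positivity) N.depth_le
    have h2 : h * ((2 * r + 1) * m) ^ N.depth ≤ h * ((2 * r + 1) * m) ^ ℓ := by gcongr
    have h3 : 0 < h * ((2 * r + 1) * m) ^ ℓ := by positivity
    omega
  have hLlog : Real.log (2 * ℓ) ≤ L := by
    rw [hL]
    refine Real.log_le_log (by positivity) ?_
    rw [le_div_iff₀ hγ]
    nlinarith
  calc (n : ℝ) ≤ 2 * (h * (((2 * r + 1 : ℕ) : ℝ) * m) ^ ℓ) := by exact_mod_cast hn2
    _ ≤ 2 * (h * ((max L 30) ^ 2 * m) ^ ℓ) := by gcongr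
    _ = 2 * (h * m ^ ℓ * (max L 30) ^ (2 * ℓ)) := by rw [mul_pow, ← pow_mul]; ring
    _ ≤ 2 * (h * m ^ ℓ *
        ((30 / Real.log 2) ^ (2 * ⌈Real.exp 30⌉₊) * L ^ (2 * ℓ))) := by
      gcongr
      exact sq_pow_max_le hℓ hLlog
    _ = _ := by ring

end ParityAttention

theorem theorem2 :
    ∃ C : ℝ, 0 < C ∧
      ∀ (n d h m ℓ : ℕ) [NeZero n]
        (A : Fin h → ParityAttention.SelfAttentionHead n d)
        (u : EuclideanSpace ℝ (Fin d) → ℝ)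
        (N : ParityAttention.NormalizedReLUNetwork d m ℓ)
        (τ γ : ℝ),
        (∀ x : Fin n → Fin 2, ParityAttention.headSum A x ∈ ParityAttention.cube d) →
        (∀ y ∈ ParityAttention.cube d, u y = N.eval (fun k => y k)) →
        0 < γ → γ ≤ 1 →
        ParityAttention.Represents τ γ (ParityAttention.attentionLayer A u)
          (ParityAttention.parity n) →
        (h : ℝ) * (m : ℝ) ^ ℓ * Real.log (2 * (ℓ : ℝ) / γ) ^ (2 * ℓ) ≥ (n : ℝ) / C := by
  have hlog2 : 0 < Real.log 2 := Real.log_pos (by norm_num)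
  refine ⟨2 * (30 / Real.log 2) ^ (2 * ⌈Real.exp 30⌉₊), by positivity, ?_⟩
  intro n d h m ℓ _ A u N τ γ hA hu hγ hγ1 hrep
  rw [ge_iff_le, div_le_iff₀ (by positivity), mul_comm _ (2 * _)]
  exact ParityAttention.represents_parity_bound A u N hA hu hγ hγ1 hrep
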